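/- Let $K$ be an algebraically closed field and let $A$ be a finite-dimensional associative unital $K$-algebra. For $d \ge 0$ let $\operatorname{mod}(A,d)$ be the affine variety of $K$-algebra homomorphisms $M \colon A \to M_d(K)$; we identify such an $M$ with the left $A$-module $K^d$ on which $a \in A$ acts as the matrix $M(a)$. Every $M \in \operatorname{mod}(A,d)$ has a minimal projective resolution $$\cdots \xrightarrow{p_2} P_1 \xrightarrow{p_1} P_0 \xrightarrow{p_0} M \to 0,$$ that is, an exact sequence with all $P_i$ finitely generated projective left $A$-modules in which each map $P_i \to \operatorname{Im}(p_i)$ is a projective cover. Let $\Omega^j(M) := \operatorname{Im}(p_j)$ be the $j$-th syzygy module of $M$ (so $\Omega^0(M) = M$); up to isomorphism it does not depend on the resolution. Then for all $d, d', j \ge 0$ the map $$\operatorname{mod}(A,d) \times \operatorname{mod}(A,d') \to \mathbb{Z}, \qquad (M,M') \mapsto \dim_K \operatorname{Hom}_A(\Omega^j(M), M')$$ is upper semicontinuous: for each $n \in \mathbb{Z}$ the set of all $(M,M')$ with $\dim_K \operatorname{Hom}_A(\Omega^j(M),M') \le n$ is open in the Zariski topology of the affine variety $\operatorname{mod}(A,d)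 \times \operatorname{mod}(A,d')$. -/

import Mathlib

open Topology

universe u v w

section ZariskiTopology

/-- The Zariski topology on the affine space `K^σ`: the closed sets are the common zero sets of
sets of polynomials. -/
abbrev affineZariski (σ : Type w) (K : Type u) [Field K] : TopologicalSpace (σ → K) :=
  TopologicalSpace.ofClosed
    {Z | ∃ S : Set (MvPolynomial σ K), Z = {x | ∀ p ∈ S, MvPolynomial.eval x p = 0}}
    ⟨{1}, by ext x; simp⟩
    (by
      intro T hT
      refine ⟨{p | ∃ Z ∈ T, ∀ x ∈ Z, MvPolynomial.eval x p = 0}, ?_⟩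
      ext x
      constructor
      · rintro hx p ⟨Z, hZ, hp⟩
        exact hp x (hx Z hZ)
      · intro hx Z hZ
        obtain ⟨S, rfl⟩ := hT hZ
        exact fun p hp => hx p ⟨_, hZ, fun y hy => hy p hp⟩)
    (by
      rintro _ ⟨S, rfl⟩ _ ⟨T, rfl⟩
      refine ⟨{r | ∃ p ∈ S, ∃ q ∈ T, r = p * q}, ?_⟩
      ext x
      constructor
      · rintro (hx | hx) _ ⟨p, hp, q, hq, rfl⟩
        · simp [hx p hp]
        · simp [hx q hq]
      · intro hx
        by_contra hcon
        simp only [Set.mem_union, Set.mem_ofPred_eq, not_or, not_forall] at hcon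
        obtain ⟨⟨p, hp, hp0⟩, q, hq, hq0⟩ := hcon
        have h := hx (p * q) ⟨p, hp, q, hq, rfl⟩
        rw [map_mul] at h
        exact (mul_ne_zero hp0 hq0) h)

end ZariskiTopology

section ModuleVarieties

variable (K : Type u) [Field K] (A : Type v) [Ring A] [Algebra K A]

/-- The points of the variety `mod(A,d)`: the `K`-algebra homomorphisms `A → M_d(K)`. -/
abbrev ModVariety (d : ℕ) : Type (max u v) :=
  A →ₐ[K] Matrix (Fin d) (Fin d) K

/-- The embedding of `mod(A,d) × mod(A,d')` into affine space: a pair `(M, M')` is sent to the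
entries of the matrices `M(b_i)` and `M'(b_i)`, where `b_1, …, b_n` is a `K`-basis of `A`. -/
noncomputable def pairCoordinates [Module.Finite K A] (d d' : ℕ)
    (x : ModVariety K A d × ModVariety K A d') :
    (Fin (Module.finrank K A) × Fin d × Fin d) ⊕
      (Fin (Module.finrank K A) × Fin d' × Fin d') → K :=
  Sum.elim
    (fun c => x.1 (Module.finBasis K A c.1) c.2.1 c.2.2)
    (fun c => x.2 (Module.finBasis K A c.1) c.2.1 c.2.2)

/-- The Zariski topology of the affine variety `mod(A,d) × mod(A,d')` (a product of varieties, so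
this is in general finer than the product of the Zariski topologies). -/
noncomputable abbrev pairZariski [Module.Finite K A] (d d' : ℕ) :
    TopologicalSpace (ModVariety K A d × ModVariety K A d') :=
  TopologicalSpace.induced (pairCoordinates K A d d') (affineZariski _ K)

variable {K A}

/-- The left `A`-module given by a point `M` of `mod(A,d)`: the space `K^d`, on which `a ∈ A`
acts as the matrix `M(a)`. -/
def ModuleOf {d : ℕ} (_M : ModVariety K A d) : Type u := Fin d → K

namespace ModuleOf

variable {d : ℕ} (M : ModVariety K A d)

instance : AddCommGroup (ModuleOf M) := inferInstanceAs (AddCommGroup (Fin d → K))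

instance : Module K (ModuleOf M) := inferInstanceAs (Module K (Fin d → K))

instance : Module A (ModuleOf M) where
  smul a m := (M a).mulVec (m : Fin d → K)
  one_smul m := by
    change (M 1).mulVec _ = _
    rw [map_one]
    exact Matrix.one_mulVec _
  mul_smul a b m := by
    change (M (a * b)).mulVec _ = (M a).mulVec ((M b).mulVec _)
    rw [map_mul]
    exact (Matrix.mulVec_mulVec _ _ _).symm
  smul_zero a := Matrix.mulVec_zero (M a)
  smul_add a m n := Matrix.mulVec_add (M a) m n
  add_smul a b m := by
    change (M (a + b)).mulVec _ = (M a).mulVec _ + (M b).mulVec _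
    rw [map_add]
    exact Matrix.add_mulVec _ _ _
  zero_smul m := by
    change (M 0).mulVec _ = _
    rw [map_zero]
    exact Matrix.zero_mulVec _

instance : IsScalarTower K A (ModuleOf M) where
  smul_assoc c a m := by
    change (M (c • a)).mulVec (m : Fin d → K) = c • (M a).mulVec (m : Fin d → K)
    rw [map_smul]
    exact Matrix.smul_mulVec c (M a) m

end ModuleOf

end ModuleVarieties

section Syzygies

/-- A submodule `L` of `P` is superfluous if `L + L' = P` implies `L' = P` for all `L'`. -/
def IsSuperfluous {A : Type v} [Ring A] {P : Type w} [AddCommGroup P] [Module A P]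
    (L : Submodule A P) : Prop :=
  ∀ L' : Submodule A P, L ⊔ L' = ⊤ → L' = ⊤

/-- A minimal projective resolution `⋯ → P₂ → P₁ → P₀ → M → 0` by finitely generated projective
`A`-modules: an exact sequence in which each map is a projective cover of its image, that is, has
a superfluous kernel. -/
structure MinimalProjectiveResolution (A : Type v) [Ring A] (M : Type u) [AddCommGroup M]
    [Module A M] where
  /-- The terms `P₀, P₁, P₂, …`. -/
  P : ℕ → ModuleCat.{v} A
  finite : ∀ i, Module.Finite A (P i)
  projective : ∀ i, Module.Projective A (P i)
  /-- The augmentation `P₀ → M`. -/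
  aug : P 0 →ₗ[A] M
  /-- The differentials `P_{i+1} → P_i`. -/
  diff : ∀ i, P (i + 1) →ₗ[A] P i
  aug_surjective : Function.Surjective aug
  exact_zero : Function.Exact (diff 0) aug
  exact_succ : ∀ i, Function.Exact (diff (i + 1)) (diff i)
  minimal_aug : IsSuperfluous (LinearMap.ker aug)
  minimal_diff : ∀ i, IsSuperfluous (LinearMap.ker (diff i))

/-- The `j`-th syzygy module `Ω^j(M)`, taken from the minimal projective resolution `R` of `M`:
`Ω⁰(M) = M`, and `Ω^{j+1}(M)` is the image of `P_{j+1} → P_j`. (The `ULift`s only put all these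
modules into the same universe.) -/
noncomputable def MinimalProjectiveResolution.syzygy {A : Type v} [Ring A] {M : Type u}
    [AddCommGroup M] [Module A M] (R : MinimalProjectiveResolution A M) :
    ℕ → ModuleCat.{max u v} A
  | 0 => ModuleCat.of A (ULift.{v} M)
  | j + 1 => ModuleCat.of A (ULift.{u} (LinearMap.range (R.diff j)))

end Syzygies

/-! Write hom(X, N) for the dimension of Hom_A(X, N). It is upper semicontinuous when X and N vary
in families with regular matrix entries, because Hom is the kernel of a matrix with regular entries
and ranks can only drop on closed sets (`isUpperSemicontinuousFor_finrank_hom`). The difficulty is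
that Ω^j(M) does not form such a family: the projective covers jump with M.

Non-minimal syzygies do vary regularly. The kernel of the standard cover A^d → M is, as a vector
space, d copies of A/K·1, and in these fixed coordinates the action of A is polynomial in M
(`exists_regular_syzygy`). Iterating gives a regular family Φ(M) of e-dimensional modules that is
stably equivalent to Ω^j(M), by Schanuel's lemma, and one more step gives Ψ(Φ(M)).

It remains to control the projective summands. Let S run through the simple modules, with projective
covers P(S). Over an algebraically closed field hom(Q, N) = ∑ hom(Q, S) · hom(P(S), N) for
projective Q (`finrank_hom_projective_eq_sum`), and minimality gives hom(P_j, S) = hom(Ω^j(M), S).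
With these, all unknown projectives cancel and, for N of dimension d', hom(Ω^{j+1}(M), N) + e·d' =
hom(Ψ(Φ(M)), N) + ∑ hom(Φ(M), S) · hom(P(S), N) (`StablyEquivalent.finrank_hom_ker`). The right side
is built from upper semicontinuous functions by sums and products of natural numbers, and e·d' is
constant. -/

/-! ### Dimensions of Hom spaces -/

section HomDimension

variable {K : Type*} [Field K] {A : Type*} [Ring A] [Algebra K A]
variable {X Y : Type*} [AddCommGroup X] [Module A X] [AddCommGroup Y] [Module A Y]
variable {N N' : Type*} [AddCommGroup N] [Module K N] [Module A N] [IsScalarTower K A N]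
variable [AddCommGroup N'] [Module K N'] [Module A N'] [IsScalarTower K A N']

variable (K N) in
/-- The free module of rank `n` represents the `n`-th power of the underlying space. -/
noncomputable def freeHomEquiv (n : ℕ) : ((Fin n → A) →ₗ[A] N) ≃ₗ[K] (Fin n → N) :=
  ((Pi.basisFun A (Fin n)).constr K).symm

/-- Hom(X, N) embeds into Hom(A^n, N) = N^n. Finiteness is needed throughout, as `finrank` is 0 on
infinite-dimensional spaces and would not be additive. -/
theorem finite_hom [Module.Finite A X] [Module.Finite K N] : Module.Finite K (X →ₗ[A] N) := by
  obtain ⟨n, f, hf⟩ := Module.Finite.exists_fin' A X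
  exact Module.Finite.of_injective ((freeHomEquiv K N n).toLinearMap ∘ₗ LinearMap.lcomp K N f)
    ((freeHomEquiv K N n).injective.comp (LinearMap.lcomp_injective_of_surjective f hf))

theorem finrank_hom_free [Module.Finite K N] (n : ℕ) :
    Module.finrank K ((Fin n → A) →ₗ[A] N) = n * Module.finrank K N := by
  rw [(freeHomEquiv K N n).finrank_eq, Module.finrank_pi_fintype]
  simp

theorem finrank_hom_congr_left (e : X ≃ₗ[A] Y) :
    Module.finrank K (X →ₗ[A] N) = Module.finrank K (Y →ₗ[A] N) :=
  (LinearEquiv.congrLeft N K e).finrank_eq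

variable (K X) in
/-- Composition with an `A`-linear map is `K`-linear. -/
def postcomp (f : N →ₗ[A] N') : (X →ₗ[A] N) →ₗ[K] (X →ₗ[A] N') where
  toFun g := f ∘ₗ g
  map_add' g h := LinearMap.comp_add g h f
  map_smul' c g := by
    ext x
    exact (f.restrictScalars K).map_smul c (g x)

@[simp]
theorem postcomp_apply (f : N →ₗ[A] N') (g : X →ₗ[A] N) : postcomp K X f g = f ∘ₗ g := rfl

theorem finrank_hom_congr_right (e : N ≃ₗ[A] N') :
    Module.finrank K (X →ₗ[A] N) = Module.finrank K (X →ₗ[A] N') := by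
  refine (LinearEquiv.ofLinearMap (postcomp K X e.toLinearMap) (postcomp K X e.symm.toLinearMap)
    ?_ ?_).finrank_eq
  · ext g x
    simp
  · ext g x
    simp

theorem finrank_hom_prod [Module.Finite A X] [Module.Finite A Y] [Module.Finite K N] :
    Module.finrank K (X × Y →ₗ[A] N) =
      Module.finrank K (X →ₗ[A] N) + Module.finrank K (Y →ₗ[A] N) := by
  have := finite_hom (K := K) (A := A) (X := X) (N := N)
  have := finite_hom (K := K) (A := A) (X := Y) (N := N)
  rw [← (LinearMap.coprodEquiv (R := A) K).finrank_eq, Module.finrank_prod]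

/-- For a projective module `X`, the dimension of `Hom(X, N)` is additive in `N`. -/
theorem finrank_hom_quotient [Module.Finite A X] [Module.Projective A X] [Module.Finite K N]
    (L : Submodule A N) :
    Module.finrank K (X →ₗ[A] N) =
      Module.finrank K (X →ₗ[A] N ⧸ L) + Module.finrank K (X →ₗ[A] L) := by
  have := finite_hom (K := K) (A := A) (X := X) (N := N)
  have hr : LinearMap.range (postcomp K X L.mkQ) = ⊤ := by
    rw [LinearMap.range_eq_top]
    exact fun g => Module.projective_lifting_property L.mkQ g L.mkQ_surjective
  have hinj : Function.Injective (postcomp K X L.subtype) := fun g h hgh => by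
    ext x
    exact congrArg (fun f : X →ₗ[A] N => f x) hgh
  have hk : LinearMap.ker (postcomp K X L.mkQ) = LinearMap.range (postcomp K X L.subtype) := by
    ext g
    rw [LinearMap.mem_ker, LinearMap.mem_range]
    constructor
    · intro hg
      refine ⟨g.codRestrict L fun x => ?_, by ext; rfl⟩
      have := congrArg (fun f : X →ₗ[A] N ⧸ L => f x) hg
      simpa using this
    · rintro ⟨f, rfl⟩
      ext x
      simp
  rw [← LinearMap.finrank_range_add_finrank_ker (postcomp K X L.mkQ), hr, finrank_top, hk,
    LinearMap.finrank_range_of_inj hinj]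

end HomDimension

/-! ### Superfluous kernels and existence of projective covers -/

section ProjectiveCovers

variable {A : Type*} [Ring A]
variable {X P : Type*} [AddCommGroup X] [Module A X] [AddCommGroup P] [Module A P]

/-- A module map with superfluous kernel induces a bijection on maps to simple modules. -/
theorem exists_comp_eq_of_isSuperfluous_ker {S : Type*} [AddCommGroup S] [Module A S]
    [IsSimpleModule A S] {p : P →ₗ[A] X} (hp : Function.Surjective p)
    (hs : IsSuperfluous (LinearMap.ker p)) (f : P →ₗ[A] S) : ∃ g : X →ₗ[A] S, g ∘ₗ p = f := by
  -- A nonzero map to a simple module has a maximal kernel, and a maximal submodule contains every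
  -- superfluous one.
  have hle : LinearMap.ker p ≤ LinearMap.ker f := by
    rcases eq_or_ne f 0 with rfl | hf
    · simp
    · have hco : IsCoatom (LinearMap.ker f) := by
        rw [← isSimpleModule_iff_isCoatom]
        have e := f.quotKerEquivOfSurjective (f.surjective_of_ne_zero hf)
        exact IsSimpleModule.congr e
      by_contra hcon
      exact hco.1 (hs _ ((sup_comm _ _).trans (hco.2 _ (lt_of_le_of_ne le_sup_left
        fun h => hcon (h ▸ le_sup_right)))))
  refine ⟨(LinearMap.ker p).liftQ f hle ∘ₗ (p.quotKerEquivOfSurjective hp).symm.toLinearMap, ?_⟩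
  ext x
  have : (p.quotKerEquivOfSurjective hp).symm (p x) = Submodule.Quotient.mk x := by
    rw [LinearEquiv.symm_apply_eq]
    rfl
  simp [this]

/-- This is how minimality of a resolution enters the dimension count: a projective cover and the
module it covers have the same multiplicities of simple quotients. -/
theorem finrank_hom_simple_eq {K : Type*} [Field K] [Algebra K A] {S : Type*} [AddCommGroup S]
    [Module K S] [Module A S] [IsScalarTower K A S] [IsSimpleModule A S] {p : P →ₗ[A] X}
    (hp : Function.Surjective p) (hs : IsSuperfluous (LinearMap.ker p)) :
    Module.finrank K (P →ₗ[A] S) = Module.finrank K (X →ₗ[A] S) :=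
  (LinearEquiv.ofBijective (LinearMap.lcomp K S p)
    ⟨LinearMap.lcomp_injective_of_surjective p hp,
      exists_comp_eq_of_isSuperfluous_ker hp hs⟩).finrank_eq.symm

/-- Over an artinian ring, every finitely generated module has a projective cover. -/
theorem exists_projectiveCover [IsArtinianRing A] (X : Type*) [AddCommGroup X] [Module A X]
    [Module.Finite A X] :
    ∃ (n : ℕ) (P : Submodule A (Fin n → A)) (p : P →ₗ[A] X), Module.Projective A P ∧
      Function.Surjective p ∧ IsSuperfluous (LinearMap.ker p) := by
  obtain ⟨n, f, hf⟩ := Module.Finite.exists_fin' A X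
  -- `P` is minimal among the submodules of A^n that still map onto `X`; this yields both
  -- projectivity and the superfluous kernel.
  obtain ⟨P, hP, hmin⟩ := IsArtinian.set_has_minimal
    {L : Submodule A (Fin n → A) | L.map f = ⊤}
    ⟨⊤, by simpa [LinearMap.range_eq_top] using hf⟩
  have hsurj : Function.Surjective (f ∘ₗ P.subtype) := by
    rw [← LinearMap.range_eq_top, LinearMap.range_comp, Submodule.range_subtype]
    exact hP
  have hmin' : ∀ L : Submodule A P, L.map (f ∘ₗ P.subtype) = ⊤ → L = ⊤ := by
    intro L hL
    rw [Submodule.map_comp] at hL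
    have h1 := hmin _ hL
    have h2 : L.map P.subtype = P := by
      by_contra hne
      exact h1 (lt_of_le_of_ne (Submodule.map_subtype_le P L) hne)
    exact Submodule.map_injective_of_injective P.injective_subtype
      (h2.trans (Submodule.map_subtype_top P).symm)
  refine ⟨n, P, f ∘ₗ P.subtype, ?_, hsurj, ?_⟩
  -- Lift `f` through `P` and restrict to `P`. The image of this endomorphism still maps onto `X`,
  -- so it is all of `P`; being noetherian, `P` then admits it only as an automorphism, and `P` is a
  -- retract of A^n.
  · obtain ⟨g, hg⟩ := Module.projective_lifting_property (f ∘ₗ P.subtype) f hsurj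
    set s : P →ₗ[A] P := g ∘ₗ P.subtype with hs
    have hfs : (f ∘ₗ P.subtype) ∘ₗ s = f ∘ₗ P.subtype := by
      rw [hs, ← LinearMap.comp_assoc, hg]
    have hss : Function.Surjective s := by
      rw [← LinearMap.range_eq_top]
      apply hmin'
      rw [← LinearMap.range_comp, hfs, LinearMap.range_eq_top]
      exact hsurj
    have hsi := IsNoetherian.injective_of_surjective_endomorphism s hss
    let e := LinearEquiv.ofBijective s ⟨hsi, hss⟩
    refine Module.Projective.of_split P.subtype (e.symm.toLinearMap ∘ₗ g) ?_
    ext1 x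
    exact e.symm_apply_apply x
  · intro L hL
    apply hmin'
    have := congrArg (Submodule.map (f ∘ₗ P.subtype)) hL
    rw [Submodule.map_sup, Submodule.map_top, LinearMap.range_eq_top.mpr hsurj] at this
    rw [← this, eq_comm, sup_eq_right]
    rintro _ ⟨x, hx, rfl⟩
    rw [LinearMap.mem_ker.mp hx]
    exact zero_mem _

end ProjectiveCovers

/-! ### Schanuel's lemma -/

section Schanuel

variable {A : Type*} [Ring A]
variable {X P Q : Type*} [AddCommGroup X] [Module A X] [AddCommGroup P] [Module A P]
  [AddCommGroup Q] [Module A Q]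

/-- The pullback of two surjections splits over a projective module. -/
theorem nonempty_eqLocus_equiv_prod [Module.Projective A P] (p : P →ₗ[A] X) (q : Q →ₗ[A] X)
    (hq : Function.Surjective q) :
    Nonempty (LinearMap.eqLocus (p ∘ₗ LinearMap.fst A P Q) (q ∘ₗ LinearMap.snd A P Q) ≃ₗ[A]
      LinearMap.ker q × P) := by
  set W := LinearMap.eqLocus (p ∘ₗ LinearMap.fst A P Q) (q ∘ₗ LinearMap.snd A P Q)
  let i : LinearMap.ker q →ₗ[A] W :=
    (LinearMap.inr A P Q ∘ₗ (LinearMap.ker q).subtype).codRestrict W fun x => by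
      simp [W, LinearMap.mem_eqLocus]
  let π : W →ₗ[A] P := LinearMap.fst A P Q ∘ₗ W.subtype
  have hi : Function.Injective i := fun x y h => by
    have := congrArg (fun w : W => (w : P × Q).2) h
    exact Subtype.ext this
  have hex : Function.Exact i π := by
    rintro ⟨⟨x, y⟩, hw⟩
    have hw' : p x = q y := hw
    constructor
    · intro hx
      have hx' : x = 0 := hx
      subst hx'
      exact ⟨⟨y, by rw [LinearMap.mem_ker, ← hw', map_zero]⟩, rfl⟩
    · rintro ⟨k, hk⟩
      exact (congrArg (fun w : W => (w : P × Q).1) hk).symm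
  obtain ⟨s, hs⟩ := Module.projective_lifting_property q p hq
  let l : P →ₗ[A] W := (LinearMap.prod LinearMap.id s).codRestrict W fun x =>
    (congrArg (fun f : P →ₗ[A] X => f x) hs).symm
  exact ⟨(hex.splitSurjectiveEquiv hi ⟨l, rfl⟩).1⟩

/-- Schanuel's lemma. -/
theorem schanuel [Module.Projective A P] [Module.Projective A Q] (p : P →ₗ[A] X) (q : Q →ₗ[A] X)
    (hp : Function.Surjective p) (hq : Function.Surjective q) :
    Nonempty ((LinearMap.ker q × P) ≃ₗ[A] LinearMap.ker p × Q) := by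
  obtain ⟨e⟩ := nonempty_eqLocus_equiv_prod p q hq
  obtain ⟨e'⟩ := nonempty_eqLocus_equiv_prod q p hp
  have h : LinearMap.eqLocus (q ∘ₗ LinearMap.fst A Q P) (p ∘ₗ LinearMap.snd A Q P) =
      (LinearMap.eqLocus (p ∘ₗ LinearMap.fst A P Q) (q ∘ₗ LinearMap.snd A P Q)).map
        (LinearEquiv.prodComm A P Q : P × Q →ₗ[A] Q × P) := by
    ext ⟨y, x⟩
    constructor
    · intro h
      exact ⟨(x, y), Eq.symm h, rfl⟩
    · rintro ⟨⟨x', y'⟩, h, h'⟩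
      cases h'
      exact Eq.symm h
  exact ⟨e.symm ≪≫ₗ (LinearEquiv.prodComm A P Q).submoduleMap _ ≪≫ₗ
    LinearEquiv.ofEq _ _ h.symm ≪≫ₗ e'⟩

end Schanuel

/-! ### A fixed choice of projective covers -/

section ChosenCovers

variable (A : Type v) [Ring A] [IsArtinianRing A]
variable (X : Type w) [AddCommGroup X] [Module A X] [Module.Finite A X]

/-- The rank of a free module containing the chosen projective cover of `X`. -/
noncomputable def coverRank : ℕ := (exists_projectiveCover (A := A) X).choose

/-- The chosen projective cover of `X`. -/
noncomputable def projectiveCover : Submodule A (Fin (coverRank A X) → A) :=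
  (exists_projectiveCover (A := A) X).choose_spec.choose

/-- The map from the chosen projective cover of `X` to `X`. -/
noncomputable def coverMap : projectiveCover A X →ₗ[A] X :=
  (exists_projectiveCover (A := A) X).choose_spec.choose_spec.choose

instance projective_projectiveCover : Module.Projective A (projectiveCover A X) :=
  (exists_projectiveCover (A := A) X).choose_spec.choose_spec.choose_spec.1

theorem coverMap_surjective : Function.Surjective (coverMap A X) :=
  (exists_projectiveCover (A := A) X).choose_spec.choose_spec.choose_spec.2.1

theorem isSuperfluous_ker_coverMap : IsSuperfluous (LinearMap.ker (coverMap A X)) :=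
  (exists_projectiveCover (A := A) X).choose_spec.choose_spec.choose_spec.2.2

end ChosenCovers

/-! ### Simple modules and Hom from projectives -/

section Simples

variable {A : Type v} [Ring A]

/-- The composition factors of a module `N` of finite length detect maps from projectives. -/
theorem IsFiniteLength.exists_finset_simple {N : Type w} [AddCommGroup N] [Module A N]
    (h : IsFiniteLength A N) : ∃ T : Finset (Submodule A A), (∀ m ∈ T, IsSimpleModule A (A ⧸ m)) ∧
      ∀ (Q : Type v) [AddCommGroup Q] [Module A Q],
        (∀ m ∈ T, ∀ f : Q →ₗ[A] A ⧸ m, f = 0) → ∀ f : Q →ₗ[A] N, f = 0 := by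
  classical
  induction h with
  | of_subsingleton =>
    refine ⟨∅, by simp, fun Q _ _ _ f => ?_⟩
    ext x
    exact Subsingleton.elim _ _
  | @of_simple_quotient M _ _ L hs _ ih =>
    obtain ⟨T, hT, hQ⟩ := ih
    obtain ⟨m, hm, ⟨e⟩⟩ := isSimpleModule_iff_quot_maximal.mp hs
    refine ⟨insert m T, ?_, fun Q _ _ hz f => ?_⟩
    · intro m' hm'
      rcases Finset.mem_insert.mp hm' with rfl | h
      · exact isSimpleModule_iff_isCoatom.mpr hm.out
      · exact hT _ h
    · have h1 : L.mkQ ∘ₗ f = 0 := by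
        have := hz m (Finset.mem_insert_self _ _) (e.toLinearMap ∘ₗ L.mkQ ∘ₗ f)
        ext x
        have hx := congrArg (fun g : Q →ₗ[A] A ⧸ m => g x) this
        simpa using hx
      have hmem : ∀ x, f x ∈ L := fun x => by
        have := congrArg (fun g : Q →ₗ[A] M ⧸ L => g x) h1
        simpa using this
      have h2 := hQ Q (fun m' hm' => hz m' (Finset.mem_insert_of_mem hm')) (f.codRestrict L hmem)
      ext x
      have := congrArg (fun g : Q →ₗ[A] L => (g x : M)) h2
      simpa using this

/-- An artinian ring has finitely many simple modules up to isomorphism. -/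
theorem exists_finset_simple_representatives [IsArtinianRing A] :
    ∃ T : Finset (Submodule A A), (∀ m ∈ T, IsSimpleModule A (A ⧸ m)) ∧
      (∀ m ∈ T, ∀ m' ∈ T, Nonempty ((A ⧸ m) ≃ₗ[A] A ⧸ m') → m = m') ∧
      ∀ m : Submodule A A, IsSimpleModule A (A ⧸ m) →
        ∃ m' ∈ T, Nonempty ((A ⧸ m) ≃ₗ[A] A ⧸ m') := by
  classical
  let p : Finset (Submodule A A) → Prop := fun T => (∀ m ∈ T, IsSimpleModule A (A ⧸ m)) ∧
    ∀ m : Submodule A A, IsSimpleModule A (A ⧸ m) →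
      ∃ m' ∈ T, Nonempty ((A ⧸ m) ≃ₗ[A] A ⧸ m')
  have hex : ∃ T, p T := by
    obtain ⟨T, hT, hQ⟩ := (isFiniteLength_iff_isNoetherian_isArtinian.mpr
      ⟨inferInstance, inferInstance⟩ : IsFiniteLength A A).exists_finset_simple
    refine ⟨T, hT, fun m hm => ?_⟩
    have hsurj := coverMap_surjective A (A ⧸ m)
    -- The projective cover of `A ⧸ m` has a nonzero map to A, hence one to a composition factor of
    -- A. That map factors through `A ⧸ m`, and Schur's lemma makes the factor isomorphic to it.
    obtain ⟨g, hg⟩ := Module.projective_lifting_property m.mkQ (coverMap A (A ⧸ m))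
      m.mkQ_surjective
    have hne : g ≠ 0 := by
      rintro rfl
      have := IsSimpleModule.nontrivial A (A ⧸ m)
      obtain ⟨y, hy⟩ := exists_ne (0 : A ⧸ m)
      obtain ⟨x, rfl⟩ := hsurj y
      exact hy (by rw [← hg]; simp)
    by_contra! hcon
    refine hne (hQ _ (fun m' hm' f => ?_) g)
    have := hT m' hm'
    obtain ⟨f', rfl⟩ := exists_comp_eq_of_isSuperfluous_ker hsurj
      (isSuperfluous_ker_coverMap A (A ⧸ m)) f
    rcases f'.bijective_or_eq_zero with hb | rfl
    · exact ((hcon m' hm').false (LinearEquiv.ofBijective f' hb)).elim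
    · simp
  -- In a minimal set of representatives no two are isomorphic, since one of them could be erased.
  obtain ⟨T, hT, hmin⟩ := WellFounded.has_min (wellFounded_lt (α := Finset (Submodule A A)))
    {T | p T} hex
  refine ⟨T, hT.1, fun m hm m' hm' ⟨e⟩ => ?_, hT.2⟩
  by_contra hne
  refine hmin (T.erase m) ⟨fun a ha => hT.1 a (Finset.mem_of_mem_erase ha), fun a ha => ?_⟩
    (Finset.erase_ssubset hm)
  obtain ⟨b, hb, ⟨e'⟩⟩ := hT.2 a ha
  rcases eq_or_ne b m with rfl | hbm
  · exact ⟨m', Finset.mem_erase.mpr ⟨Ne.symm hne, hm'⟩, ⟨e' ≪≫ₗ e⟩⟩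
  · exact ⟨b, Finset.mem_erase.mpr ⟨hbm, hb⟩, ⟨e'⟩⟩

variable {K : Type u} [Field K] [Algebra K A]

theorem finrank_end_simple [IsAlgClosed K] {S : Type w} [AddCommGroup S] [Module K S] [Module A S]
    [IsScalarTower K A S] [Module.Finite K S] [IsSimpleModule A S] :
    Module.finrank K (S →ₗ[A] S) = 1 := by
  have h := IsSimpleModule.algebraMap_end_bijective_of_isAlgClosed (A := A) (V := S) K
  exact (LinearEquiv.ofBijective (Algebra.linearMap K (Module.End A S)) h).finrank_eq.symm.trans
    (Module.finrank_self K)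

/-- The dimension of `Hom(Q, N)` for `Q` projective, in terms of multiplicities of simples. -/
theorem finrank_hom_projective_eq_sum [IsAlgClosed K] [IsArtinianRing A] [Module.Finite K A]
    {T : Finset (Submodule A A)} (hT : ∀ m ∈ T, IsSimpleModule A (A ⧸ m))
    (hinj : ∀ m ∈ T, ∀ m' ∈ T, Nonempty ((A ⧸ m) ≃ₗ[A] A ⧸ m') → m = m')
    (hall : ∀ m : Submodule A A, IsSimpleModule A (A ⧸ m) →
        ∃ m' ∈ T, Nonempty ((A ⧸ m) ≃ₗ[A] A ⧸ m'))
    {Q : Type*} [AddCommGroup Q] [Module A Q] [Module.Finite A Q] [Module.Projective A Q]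
    {N : Type w} [AddCommGroup N] [Module A N] (h : IsFiniteLength A N) [Module K N]
    [IsScalarTower K A N] [Module.Finite K N] :
    Module.finrank K (Q →ₗ[A] N) = ∑ m ∈ T, Module.finrank K (Q →ₗ[A] A ⧸ m) *
      Module.finrank K (projectiveCover A (A ⧸ m) →ₗ[A] N) := by
  classical
  -- The induction runs over A-modules, so the K-structure is generalized to let the hypothesis
  -- apply to the submodule `L`.
  rename_i iK iT iF
  revert iK iT iF
  induction h with
  | @of_subsingleton M _ _ _ =>
    intro _ _ _
    rw [Module.finrank_zero_of_subsingleton, eq_comm]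
    exact Finset.sum_eq_zero fun m _ =>
      mul_eq_zero_of_right _ Module.finrank_zero_of_subsingleton
  | @of_simple_quotient M _ _ L hs _ ih =>
    intro _ _ _
    have := Module.Finite.of_injective (L.subtype.restrictScalars K) L.injective_subtype
    have := Module.Finite.of_surjective (L.mkQ.restrictScalars K) L.mkQ_surjective
    rw [finrank_hom_quotient L, ih, Finset.sum_congr rfl
      fun m _ => congrArg _ (finrank_hom_quotient (X := projectiveCover A (A ⧸ m)) L)]
    simp only [mul_add, Finset.sum_add_distrib, Nat.add_right_cancel_iff]
    obtain ⟨m, hm, ⟨e⟩⟩ := isSimpleModule_iff_quot_maximal.mp hs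
    obtain ⟨m', hm', ⟨e'⟩⟩ := hall m (isSimpleModule_iff_isCoatom.mpr hm.out)
    have e'' := e ≪≫ₗ e'
    have := hT m' hm'
    have := Module.Finite.of_surjective (m'.mkQ.restrictScalars K) m'.mkQ_surjective
    -- By additivity only the simple quotient `M ⧸ L` is left. Its representative `m'` contributes
    -- hom(P(S), S) = hom(S, S) = 1; the other terms vanish by Schur's lemma.
    rw [Finset.sum_eq_single_of_mem m' hm']
    · rw [finrank_hom_congr_right (X := projectiveCover A (A ⧸ m')) e'',
        finrank_hom_simple_eq (coverMap_surjective A (A ⧸ m'))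
          (isSuperfluous_ker_coverMap A (A ⧸ m')), finrank_end_simple, mul_one,
        finrank_hom_congr_right e'']
    · intro a ha hne
      have := hT a ha
      rw [finrank_hom_congr_right (X := projectiveCover A (A ⧸ a)) e'',
        finrank_hom_simple_eq (coverMap_surjective A (A ⧸ a))
          (isSuperfluous_ker_coverMap A (A ⧸ a))]
      have : Subsingleton ((A ⧸ a) →ₗ[A] A ⧸ m') := by
        refine subsingleton_of_forall_eq 0 fun f => ?_
        rcases f.bijective_or_eq_zero with hb | hz
        · exact (hne (hinj a ha m' hm' ⟨LinearEquiv.ofBijective f hb⟩)).elim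
        · exact hz
      exact mul_eq_zero_of_right _ Module.finrank_zero_of_subsingleton

end Simples

/-! ### Upper semicontinuity over an algebra of functions -/

section Semicontinuity

variable {K : Type*} [Field K] {X : Type*}

/-- Upper semicontinuity of `f : X → ℕ` for the topology on `X` whose basic open sets are the
nonvanishing loci of the functions in `R`. -/
def IsUpperSemicontinuousFor (R : Subalgebra K (X → K)) (f : X → ℕ) : Prop :=
  ∀ x₀, ∃ g ∈ R, g x₀ ≠ 0 ∧ ∀ x, g x ≠ 0 → f x ≤ f x₀

namespace IsUpperSemicontinuousFor

variable {R : Subalgebra K (X → K)} {f g : X → ℕ}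

theorem const (n : ℕ) : IsUpperSemicontinuousFor R fun _ => n :=
  fun _ => ⟨1, one_mem R, one_ne_zero, fun _ _ => le_rfl⟩

theorem map₂ {op : ℕ → ℕ → ℕ} (hop : ∀ a b c d, a ≤ c → b ≤ d → op a b ≤ op c d)
    (hf : IsUpperSemicontinuousFor R f) (hg : IsUpperSemicontinuousFor R g) :
    IsUpperSemicontinuousFor R fun x => op (f x) (g x) := by
  intro x₀
  obtain ⟨p, hp, hp0, hpf⟩ := hf x₀
  obtain ⟨q, hq, hq0, hqg⟩ := hg x₀
  refine ⟨p * q, mul_mem hp hq, mul_ne_zero hp0 hq0, fun x hx => ?_⟩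
  exact hop _ _ _ _ (hpf x (left_ne_zero_of_mul hx)) (hqg x (right_ne_zero_of_mul hx))

theorem add (hf : IsUpperSemicontinuousFor R f) (hg : IsUpperSemicontinuousFor R g) :
    IsUpperSemicontinuousFor R fun x => f x + g x :=
  map₂ (fun _ _ _ _ => Nat.add_le_add) hf hg

theorem mul (hf : IsUpperSemicontinuousFor R f) (hg : IsUpperSemicontinuousFor R g) :
    IsUpperSemicontinuousFor R fun x => f x * g x :=
  map₂ (fun _ _ _ _ => Nat.mul_le_mul) hf hg

theorem sum {ι : Type*} (T : Finset ι) {f : ι → X → ℕ}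
    (hf : ∀ i ∈ T, IsUpperSemicontinuousFor R (f i)) :
    IsUpperSemicontinuousFor R fun x => ∑ i ∈ T, f i x := by
  classical
  induction T using Finset.induction_on with
  | empty => simpa using const 0
  | insert a T ha ih =>
    simp only [Finset.sum_insert ha]
    exact (hf a (Finset.mem_insert_self _ _)).add
      (ih fun i hi => hf i (Finset.mem_insert_of_mem hi))

theorem of_add_const (c : ℕ) (hf : IsUpperSemicontinuousFor R fun x => f x + c) :
    IsUpperSemicontinuousFor R f := fun x₀ => by
  obtain ⟨p, hp, hp0, hpf⟩ := hf x₀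
  exact ⟨p, hp, hp0, fun x hx => Nat.le_of_add_le_add_right (hpf x hx)⟩

end IsUpperSemicontinuousFor

/-- Evaluation at a point, on an algebra of functions. -/
def evalAt (R : Subalgebra K (X → K)) (x : X) : R →ₐ[K] K :=
  (Pi.evalAlgHom K (fun _ : X => K) x).comp R.val

@[simp]
theorem evalAt_apply (R : Subalgebra K (X → K)) (x : X) (g : R) :
    evalAt R x g = (g : X → K) x := rfl

/-- A matrix of rank `r` has an invertible compression of size `r`. -/
theorem Matrix.exists_mul_mul_eq_one {m n : Type*} [Fintype m] [Fintype n] [DecidableEq m]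
    [DecidableEq n] (B : Matrix m n K) :
    ∃ (V : Matrix (Fin B.rank) m K) (W : Matrix n (Fin B.rank) K), V * B * W = 1 := by
  let e : LinearMap.range B.mulVecLin ≃ₗ[K] (Fin B.rank → K) :=
    (Module.finBasis K (LinearMap.range B.mulVecLin)).equivFun
  obtain ⟨W, hW⟩ := LinearMap.exists_rightInverse_of_surjective
    (e.toLinearMap ∘ₗ B.mulVecLin.rangeRestrict)
    (by rw [LinearMap.range_eq_top]; exact e.surjective.comp B.mulVecLin.surjective_rangeRestrict)
  obtain ⟨V, hV⟩ := LinearMap.exists_leftInverse_of_injective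
    ((LinearMap.range B.mulVecLin).subtype ∘ₗ e.symm.toLinearMap)
    (by rw [LinearMap.ker_eq_bot]; exact (Submodule.injective_subtype _).comp e.symm.injective)
  refine ⟨LinearMap.toMatrix' V, LinearMap.toMatrix' W, ?_⟩
  apply Matrix.toLin'.injective
  rw [Matrix.toLin'_mul, Matrix.toLin'_mul, Matrix.toLin'_toMatrix', Matrix.toLin'_toMatrix',
    Matrix.toLin'_one]
  apply LinearMap.ext
  intro w
  have h1 := congrArg (fun f => f w) hW
  have h2 := congrArg (fun f => f w) hV
  have h3 : B.mulVecLin.rangeRestrict (W w) = e.symm w := by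
    rw [LinearEquiv.eq_symm_apply]
    exact h1
  have h4 : B.mulVecLin (W w) = (e.symm w : m → K) := congrArg Subtype.val h3
  change V (B.mulVecLin (W w)) = w
  rw [h4]
  exact h2

/-- The dimension of the kernel of a matrix with regular entries is upper semicontinuous. -/
theorem isUpperSemicontinuousFor_finrank_ker {R : Subalgebra K (X → K)} {m n : Type*} [Fintype m]
    [Fintype n] [DecidableEq m] [DecidableEq n] (B : Matrix m n R) :
    IsUpperSemicontinuousFor R fun x =>
      Module.finrank K (LinearMap.ker (B.map (evalAt R x)).mulVecLin) := by
  intro x₀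
  obtain ⟨V, W, hVW⟩ := (B.map (evalAt R x₀)).exists_mul_mul_eq_one
  -- `V` and `W` are chosen at `x₀` and kept constant. So det `C` is regular, equals 1 at `x₀`, and
  -- forces rank at least that of `B` at `x₀` wherever it is nonzero.
  let C := V.map (algebraMap K R) * B * W.map (algebraMap K R)
  have hC : ∀ x, C.map (evalAt R x) = V * B.map (evalAt R x) * W := fun x => by
    have hV : (V.map (algebraMap K R)).map (evalAt R x) = V := by
      ext i j
      simp
    have hW : (W.map (algebraMap K R)).map (evalAt R x) = W := by
      ext i j
      simp
    simp only [C, Matrix.map_mul, hV, hW]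
  have hdet : ∀ x, (C.det : X → K) x = (V * B.map (evalAt R x) * W).det := fun x => by
    rw [← hC, ← evalAt_apply, AlgHom.map_det]
    rfl
  refine ⟨C.det, C.det.2, ?_, fun x hx => ?_⟩
  · rw [hdet, hVW, Matrix.det_one]
    exact one_ne_zero
  · rw [hdet] at hx
    have hr := Matrix.rank_of_isUnit _ ((Matrix.isUnit_iff_isUnit_det _).mpr hx.isUnit)
    have h1 := (Matrix.rank_mul_le_left (V * B.map (evalAt R x)) W).trans
      (Matrix.rank_mul_le_right V (B.map (evalAt R x)))
    rw [hr, Fintype.card_fin] at h1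
    dsimp only
    have h2 := LinearMap.finrank_range_add_finrank_ker (B.map (evalAt R x)).mulVecLin
    have h3 := LinearMap.finrank_range_add_finrank_ker (B.map (evalAt R x₀)).mulVecLin
    unfold Matrix.rank at h1
    omega

end Semicontinuity

/-! ### Hom between regular families -/

section Families

variable {K : Type u} [Field K] {A : Type v} [Ring A] [Algebra K A] {X : Type*}

/-- A family of points of `mod(A,d)` whose matrix entries are regular functions. -/
def IsRegularFamily (R : Subalgebra K (X → K)) {d : ℕ} (φ : X → ModVariety K A d) : Prop :=
  ∀ a i j, (fun x => φ x a i j) ∈ R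

theorem IsRegularFamily.const (R : Subalgebra K (X → K)) {d : ℕ} (M : ModVariety K A d) :
    IsRegularFamily R fun _ : X => M :=
  fun a i j => R.algebraMap_mem (M a i j)

instance ModuleOf.finite {d : ℕ} (M : ModVariety K A d) : Module.Finite K (ModuleOf M) :=
  inferInstanceAs (Module.Finite K (Fin d → K))

theorem ModuleOf.finrank_eq {d : ℕ} (M : ModVariety K A d) :
    Module.finrank K (ModuleOf M) = d :=
  Module.finrank_fin_fun K

/-- The entries of the matrix of the linear map `F ↦ (M'(b) F - F M(b))_b`, where `b` runs through
a basis, that cuts out the space of homomorphisms. -/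
def homMatrix [Module.Finite K A] {S : Type*} [CommRing S] {d d' : ℕ}
    (α : Fin (Module.finrank K A) → Matrix (Fin d) (Fin d) S)
    (β : Fin (Module.finrank K A) → Matrix (Fin d') (Fin d') S) :
    Matrix (Fin (Module.finrank K A) × Fin d' × Fin d) (Fin d' × Fin d) S :=
  Matrix.of fun r c => (if r.2.2 = c.2 then β r.1 r.2.1 c.1 else 0) -
    (if r.2.1 = c.1 then α r.1 c.2 r.2.2 else 0)

theorem homMatrix_mulVec [Module.Finite K A] {S : Type*} [CommRing S] {d d' : ℕ}
    (α : Fin (Module.finrank K A) → Matrix (Fin d) (Fin d) S)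
    (β : Fin (Module.finrank K A) → Matrix (Fin d') (Fin d') S) (f : Fin d' × Fin d → S)
    (r : Fin (Module.finrank K A) × Fin d' × Fin d) :
    (homMatrix α β).mulVec f r = (β r.1 * Matrix.of (fun i j => f (i, j)) -
      Matrix.of (fun i j => f (i, j)) * α r.1) r.2.1 r.2.2 := by
  simp only [Matrix.mulVec, dotProduct, homMatrix, Matrix.of_apply, Matrix.sub_apply,
    Matrix.mul_apply, sub_mul, Finset.sum_sub_distrib, Fintype.sum_prod_type, ite_mul, zero_mul,
    Finset.sum_ite_eq, Finset.mem_univ, if_true]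
  congr 1
  rw [Finset.sum_comm]
  simp [mul_comm]

theorem finrank_hom_eq_finrank_ker [Module.Finite K A] {d d' : ℕ} (M : ModVariety K A d)
    (M' : ModVariety K A d') :
    Module.finrank K (ModuleOf M →ₗ[A] ModuleOf M') =
      Module.finrank K (LinearMap.ker (homMatrix (fun b => M (Module.finBasis K A b))
        (fun b => M' (Module.finBasis K A b))).mulVecLin) := by
  let Φ : (ModuleOf M →ₗ[A] ModuleOf M') →ₗ[K] (Fin d' × Fin d → K) :=
    { toFun := fun f c => LinearMap.toMatrix' (f.restrictScalars K : (Fin d → K) →ₗ[K] (Fin d' → K))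
        c.1 c.2
      map_add' := fun f g => by
        ext c
        rfl
      map_smul' := fun t f => by
        ext c
        rfl }
  have hinj : Function.Injective Φ := fun f g h => by
    have h' : (f.restrictScalars K : (Fin d → K) →ₗ[K] (Fin d' → K)) =
        (g.restrictScalars K : (Fin d → K) →ₗ[K] (Fin d' → K)) := by
      apply LinearMap.toMatrix'.injective
      ext i j
      exact congrFun h (i, j)
    ext x
    exact congrArg (fun k : (Fin d → K) →ₗ[K] (Fin d' → K) => k x) h'
  rw [← LinearMap.finrank_range_of_inj hinj]
  suffices h : LinearMap.range Φ = LinearMap.ker (homMatrix (fun b => M (Module.finBasis K A b))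
      (fun b => M' (Module.finBasis K A b))).mulVecLin by rw [h]
  ext f
  rw [LinearMap.mem_range, LinearMap.mem_ker]
  constructor
  · rintro ⟨g, rfl⟩
    ext r
    rw [Matrix.mulVecLin_apply, homMatrix_mulVec]
    set a := Module.finBasis K A r.1
    let G : (Fin d → K) →ₗ[K] (Fin d' → K) := g.restrictScalars K
    have : M' a * LinearMap.toMatrix' G = LinearMap.toMatrix' G * M a := by
      apply Matrix.toLin'.injective
      rw [Matrix.toLin'_mul, Matrix.toLin'_mul, Matrix.toLin'_toMatrix']
      apply LinearMap.ext
      intro x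
      exact (g.map_smul a x).symm
    exact congrFun (congrFun (sub_eq_zero.mpr this) r.2.1) r.2.2
  · intro hf
    let F : Matrix (Fin d') (Fin d) K := Matrix.of fun i j => f (i, j)
    have hb : ∀ b, M' (Module.finBasis K A b) * F = F * M (Module.finBasis K A b) := fun b => by
      rw [← sub_eq_zero]
      ext i j
      have := congrFun hf (b, i, j)
      rw [Matrix.mulVecLin_apply, homMatrix_mulVec] at this
      exact this
    have ha : ∀ a, M' a * F = F * M a := by
      let D : A →ₗ[K] Matrix (Fin d') (Fin d) K :=
        { toFun := fun a => M' a * F - F * M a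
          map_add' := fun a b => by
            simp only [map_add, Matrix.add_mul, Matrix.mul_add]
            abel
          map_smul' := fun c a => by
            simp only [map_smul, Matrix.smul_mul, Matrix.mul_smul, smul_sub, RingHom.id_apply] }
      have hD : D = 0 := (Module.finBasis K A).ext fun b => sub_eq_zero.mpr (hb b)
      exact fun a => sub_eq_zero.mp (congrArg (fun f : A →ₗ[K] Matrix (Fin d') (Fin d) K => f a) hD)
    refine ⟨{ toFun := fun x => F.mulVec x
              map_add' := fun x y => Matrix.mulVec_add F x y
              map_smul' := fun a x => ?_ }, ?_⟩
    · change F.mulVec ((M a).mulVec x) = (M' a).mulVec (F.mulVec x)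
      exact (Matrix.mulVec_mulVec _ _ _).trans
        ((congrArg (fun B => B.mulVec (x : Fin d → K)) (ha a)).symm.trans
          (Matrix.mulVec_mulVec _ _ _).symm)
    · ext c
      exact congrFun (congrFun (LinearMap.toMatrix'_toLin' F) c.1) c.2

theorem isUpperSemicontinuousFor_finrank_hom [Module.Finite K A] {R : Subalgebra K (X → K)}
    {d d' : ℕ} {φ : X → ModVariety K A d} {ψ : X → ModVariety K A d'} (hφ : IsRegularFamily R φ)
    (hψ : IsRegularFamily R ψ) : IsUpperSemicontinuousFor R fun x =>
      Module.finrank K (ModuleOf (φ x) →ₗ[A] ModuleOf (ψ x)) := by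
  have := isUpperSemicontinuousFor_finrank_ker (R := R) (homMatrix (K := K) (A := A)
    (fun b => Matrix.of fun i j => ⟨_, hφ (Module.finBasis K A b) i j⟩)
    (fun b => Matrix.of fun i j => ⟨_, hψ (Module.finBasis K A b) i j⟩))
  convert this using 2 with x
  rw [finrank_hom_eq_finrank_ker]
  refine congrArg (fun B : Matrix (Fin (Module.finrank K A) × Fin d' × Fin d) (Fin d' × Fin d) K =>
    Module.finrank K (LinearMap.ker B.mulVecLin)) (Matrix.ext fun r c => ?_)
  simp only [homMatrix, Matrix.map_apply, Matrix.of_apply, map_sub]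
  split_ifs <;> simp

end Families

/-! ### Regular choice of a non-minimal syzygy -/

section Points

variable {K : Type u} [Field K] {A : Type v} [Ring A] [Algebra K A]

/-- The point of `mod(A,m)` given by an `A`-module with a `K`-basis of `m` elements. -/
noncomputable def pointOfBasis {V : Type w} [AddCommGroup V] [Module K V] [Module A V]
    [IsScalarTower K A V] {m : ℕ} (b : Module.Basis (Fin m) K V) : ModVariety K A m :=
  (LinearMap.toMatrixAlgEquiv b).toAlgHom.comp (Algebra.lsmul K K V)

theorem pointOfBasis_apply {V : Type w} [AddCommGroup V] [Module K V] [Module A V]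
    [IsScalarTower K A V] {m : ℕ} (b : Module.Basis (Fin m) K V) (a : A) (i j : Fin m) :
    pointOfBasis (A := A) b a i j = b.repr (a • b j) i :=
  LinearMap.toMatrixAlgEquiv_apply b _ i j

/-- A module with a basis is isomorphic to the module given by the corresponding point. -/
noncomputable def equivModuleOfPointOfBasis {V : Type w} [AddCommGroup V] [Module K V] [Module A V]
    [IsScalarTower K A V] {m : ℕ} (b : Module.Basis (Fin m) K V) :
    V ≃ₗ[A] ModuleOf (pointOfBasis (A := A) b) :=
  { b.equivFun with
    map_smul' := fun a v =>
      (LinearMap.toMatrix_mulVec_repr b b (Algebra.lsmul K K V a) v).symm }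

/-- Every finite-dimensional module is isomorphic to one given by a point. -/
theorem exists_equiv_moduleOf (V : Type w) [AddCommGroup V] [Module K V] [Module A V]
    [IsScalarTower K A V] [Module.Finite K V] :
    ∃ (m : ℕ) (M : ModVariety K A m), Nonempty (V ≃ₗ[A] ModuleOf M) :=
  ⟨_, _, ⟨equivModuleOfPointOfBasis (Module.finBasis K V)⟩⟩

variable {d : ℕ}

/-- The standard free cover of the module given by a point. -/
noncomputable def freeCover (M : ModVariety K A d) : (Fin d → A) →ₗ[A] ModuleOf M :=
  Fintype.linearCombination A fun t => (Pi.single t (1 : K) : Fin d → K)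

theorem freeCover_apply (M : ModVariety K A d) (v : Fin d → A) (i : Fin d) :
    (freeCover M v : Fin d → K) i = ∑ t, M (v t) i t := by
  have h : (freeCover M v : Fin d → K) =
      ∑ t, (M (v t)).mulVec (Pi.single t (1 : K) : Fin d → K) := rfl
  rw [h, Finset.sum_apply]
  simp [Matrix.mulVec_single]

/-- Scalar vectors give a K-linear section of the cover that is the same for every `M`. Hence its
image is a complement of the kernel independent of `M`. -/
theorem freeCover_algebraMap (M : ModVariety K A d) (u : Fin d → K) :
    (freeCover M (fun t => algebraMap K A (u t)) : Fin d → K) = u := by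
  funext i
  rw [freeCover_apply]
  simp [Matrix.algebraMap_matrix_apply]

theorem freeCover_surjective (M : ModVariety K A d) : Function.Surjective (freeCover M) :=
  fun u => ⟨_, freeCover_algebraMap M u⟩

/-- The kernel of the free cover is, as a vector space, independent of the point: it is isomorphic
to `d` copies of a complement of the scalars in `A`. -/
noncomputable def kerFreeCoverEquiv {k : ℕ} (ρ : A →ₗ[K] (Fin k → K)) (σ : (Fin k → K) →ₗ[K] A)
    (hσ : ρ ∘ₗ σ = LinearMap.id) (hρ : LinearMap.ker ρ = LinearMap.range (Algebra.linearMap K A))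
    (M : ModVariety K A d) :
    LinearMap.ker (freeCover M) ≃ₗ[K] (Fin k × Fin d → K) where
  toFun v c := ρ ((v : Fin d → A) c.2) c.1
  map_add' v w := by
    ext c
    simp
  map_smul' c v := by
    ext c
    simp
  -- Lift by `σ`, then subtract scalars, which `ρ` does not see, to land in the kernel.
  invFun w := ⟨fun t => σ (fun s => w (s, t)) -
      algebraMap K A ((freeCover M (fun t => σ (fun s => w (s, t))) : Fin d → K) t), by
    rw [LinearMap.mem_ker]
    exact (map_sub (freeCover M) _ _).trans (sub_eq_zero.mpr (freeCover_algebraMap M _).symm)⟩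
  left_inv v := by
    have h1 : ∀ t, ∃ c : K, algebraMap K A c = (v : Fin d → A) t - σ (ρ ((v : Fin d → A) t)) := by
      intro t
      have : (v : Fin d → A) t - σ (ρ ((v : Fin d → A) t)) ∈ LinearMap.ker ρ := by
        rw [LinearMap.mem_ker, map_sub, sub_eq_zero]
        exact (congrArg (fun f => f (ρ ((v : Fin d → A) t))) hσ).symm
      rw [hρ] at this
      exact this
    choose c hc using h1
    have h2 : (freeCover M (fun t => σ (ρ ((v : Fin d → A) t))) : Fin d → K) = -c := by
      have h3 : (fun t => σ (ρ ((v : Fin d → A) t))) =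
          (v : Fin d → A) - fun t => algebraMap K A (c t) := by
        funext t
        simp [hc]
      rw [h3]
      refine (map_sub (freeCover M) _ _).trans ?_
      rw [LinearMap.mem_ker.mp v.2, zero_sub]
      exact congrArg Neg.neg (freeCover_algebraMap M c)
    apply Subtype.ext
    funext t
    change σ (ρ ((v : Fin d → A) t)) - algebraMap K A
      ((freeCover M (fun t => σ (ρ ((v : Fin d → A) t))) : Fin d → K) t) = _
    rw [h2, Pi.neg_apply, map_neg, hc]
    abel
  right_inv w := by
    ext c
    have h1 : ∀ u, ρ (algebraMap K A u) = 0 := fun u => by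
      have : algebraMap K A u ∈ LinearMap.ker ρ := hρ ▸ ⟨u, rfl⟩
      exact this
    have h2 : ∀ u, ρ (σ u) = u := fun u => congrArg (fun f => f u) hσ
    simp [h1, h2]

/-- In the fixed coordinates the entries of `M` occur only linearly, with coefficients independent
of `M`; regularity of the syzygy follows from this. -/
theorem kerFreeCoverEquiv_smul_symm {k : ℕ} (ρ : A →ₗ[K] (Fin k → K)) (σ : (Fin k → K) →ₗ[K] A)
    (hσ : ρ ∘ₗ σ = LinearMap.id) (hρ : LinearMap.ker ρ = LinearMap.range (Algebra.linearMap K A))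
    (M : ModVariety K A d) (a : A) (w : Fin k × Fin d → K) (c : Fin k × Fin d) :
    kerFreeCoverEquiv ρ σ hσ hρ M (a • (kerFreeCoverEquiv ρ σ hσ hρ M).symm w) c =
      ρ (a * σ fun s => w (s, c.2)) c.1 - (∑ t, M (σ fun s => w (s, t)) c.2 t) * ρ a c.1 := by
  change ρ (a * (σ (fun s => w (s, c.2)) - algebraMap K A
    ((freeCover M (fun t => σ (fun s => w (s, t))) : Fin d → K) c.2))) c.1 = _
  rw [freeCover_apply, mul_sub, ← Algebra.commutes, ← Algebra.smul_def, map_sub, map_smul]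
  rfl

variable (K A d) in
/-- There is a regular map `mod(A,d) → mod(A,d₁)` whose value at `M` is the kernel of the standard
free cover of `M`. -/
theorem exists_regular_syzygy [Module.Finite K A] :
    ∃ (d₁ : ℕ) (Φ : ModVariety K A d → ModVariety K A d₁),
      (∀ M, Nonempty (LinearMap.ker (freeCover M) ≃ₗ[A] ModuleOf (Φ M))) ∧
      ∀ {X : Type max u v} {R : Subalgebra K (X → K)} {φ : X → ModVariety K A d},
        IsRegularFamily R φ → IsRegularFamily R fun x => Φ (φ x) := by
  let L : Submodule K A := LinearMap.range (Algebra.linearMap K A)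
  let e : (A ⧸ L) ≃ₗ[K] (Fin (Module.finrank K (A ⧸ L)) → K) :=
    (Module.finBasis K (A ⧸ L)).equivFun
  let ρ := e.toLinearMap ∘ₗ L.mkQ
  obtain ⟨σ, hσ⟩ := LinearMap.exists_rightInverse_of_surjective ρ
    (LinearMap.range_eq_top.mpr (e.surjective.comp L.mkQ_surjective))
  have hρ : LinearMap.ker ρ = L := by
    rw [LinearEquiv.ker_comp, Submodule.ker_mkQ]
  let κ := fun M : ModVariety K A d => kerFreeCoverEquiv ρ σ hσ hρ M
  let b := fun M => Module.Basis.ofEquivFun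
    (κ M ≪≫ₗ LinearEquiv.funCongrLeft K K finProdFinEquiv.symm)
  refine ⟨_, fun M => pointOfBasis (b M), fun M => ⟨equivModuleOfPointOfBasis (b M)⟩, ?_⟩
  intro X R φ hφ a i j
  have h : ∀ x, pointOfBasis (A := A) (b (φ x)) a i j =
      ρ (a * σ fun s => (Pi.single j (1 : K) : _ → K) (finProdFinEquiv (s, (finProdFinEquiv.symm i).2)))
        (finProdFinEquiv.symm i).1 -
      (∑ t, φ x (σ fun s => (Pi.single j (1 : K) : _ → K) (finProdFinEquiv (s, t)))
        (finProdFinEquiv.symm i).2 t) * ρ a (finProdFinEquiv.symm i).1 := fun x => by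
    rw [pointOfBasis_apply, Module.Basis.coe_ofEquivFun]
    exact kerFreeCoverEquiv_smul_symm ρ σ hσ hρ (φ x) a _ _
  simp only [h]
  refine sub_mem (R.algebraMap_mem _) (mul_mem ?_ (R.algebraMap_mem _))
  have := sum_mem fun t (_ : t ∈ Finset.univ) => hφ
    (σ fun s => (Pi.single j (1 : K) : _ → K) (finProdFinEquiv (s, t))) (finProdFinEquiv.symm i).2 t
  convert this using 1
  funext x
  simp

end Points

/-! ### Existence of minimal projective resolutions -/

section Resolutions

theorem exact_subtype_comp {A : Type*} [Ring A] {C P Y : Type*} [AddCommGroup C] [Module A C]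
    [AddCommGroup P] [Module A P] [AddCommGroup Y] [Module A Y] {L : Submodule A P}
    {c : C →ₗ[A] L} (hc : Function.Surjective c) (f : P →ₗ[A] Y) (h : LinearMap.ker f = L) :
    Function.Exact (L.subtype ∘ₗ c) f := by
  rw [LinearMap.exact_iff, LinearMap.range_comp, LinearMap.range_eq_top.mpr hc,
    Submodule.map_subtype_top, h]

theorem isSuperfluous_of_eq {A : Type v} [Ring A] {P : Type w} [AddCommGroup P] [Module A P]
    {L L' : Submodule A P} (h : L = L') (hL : IsSuperfluous L) : IsSuperfluous L' :=
  h ▸ hL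

variable (A : Type v) [Ring A] [IsArtinianRing A]

/-- A finitely generated projective module together with a submodule: a stage in the construction
of a minimal projective resolution. -/
structure ResolutionStage where
  /-- The projective module. -/
  P : ModuleCat.{v} A
  /-- The submodule, to be covered in the next stage. -/
  L : Submodule A P
  finite : Module.Finite A P
  projective : Module.Projective A P

attribute [instance] ResolutionStage.finite ResolutionStage.projective

variable {A}

/-- The projective cover of the given submodule, with the kernel of the covering map. -/
noncomputable def ResolutionStage.next (s : ResolutionStage A) : ResolutionStage A where
  P := ModuleCat.of A (projectiveCover A s.L)
  L := LinearMap.ker (coverMap A s.L)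
  finite := inferInstanceAs (Module.Finite A (projectiveCover A s.L))
  projective := projective_projectiveCover A s.L

variable (A)

/-- The stages of a minimal projective resolution of `M`. -/
noncomputable def resolutionStages (M : Type w) [AddCommGroup M] [Module A M] [Module.Finite A M] :
    ℕ → ResolutionStage A
  | 0 =>
    { P := ModuleCat.of A (projectiveCover A M)
      L := LinearMap.ker (coverMap A M)
      finite := inferInstanceAs (Module.Finite A (projectiveCover A M))
      projective := projective_projectiveCover A M }
  | i + 1 => (resolutionStages M i).next

/-- Over an artinian ring, every finitely generated module has a minimal projective resolution. -/
noncomputable def minimalProjectiveResolution (M : Type u) [AddCommGroup M] [Module A M]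
    [Module.Finite A M] : MinimalProjectiveResolution A M where
  P i := (resolutionStages A M i).P
  finite i := (resolutionStages A M i).finite
  projective i := (resolutionStages A M i).projective
  aug := coverMap A M
  diff i := (resolutionStages A M i).L.subtype ∘ₗ coverMap A (resolutionStages A M i).L
  aug_surjective := coverMap_surjective A M
  exact_zero := exact_subtype_comp (coverMap_surjective _ _) _ rfl
  exact_succ _ := exact_subtype_comp (coverMap_surjective _ _) _
    (LinearMap.ker_comp_of_ker_eq_bot _ (Submodule.ker_subtype _))
  minimal_aug := isSuperfluous_ker_coverMap A M
  minimal_diff i := isSuperfluous_of_eq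
    (LinearMap.ker_comp_of_ker_eq_bot _ (Submodule.ker_subtype _)).symm
    (isSuperfluous_ker_coverMap A (resolutionStages A M i).L)

end Resolutions

/-- Each syzygy is covered by the corresponding term of the resolution, with kernel the next
syzygy. -/
theorem MinimalProjectiveResolution.exists_cover_syzygy {A : Type v} [Ring A]
    {M : Type u} [AddCommGroup M] [Module A M] (R : MinimalProjectiveResolution A M) (j : ℕ) :
    ∃ p : R.P j →ₗ[A] R.syzygy j, Function.Surjective p ∧ IsSuperfluous (LinearMap.ker p) ∧
      Nonempty (LinearMap.ker p ≃ₗ[A] R.syzygy (j + 1)) := by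
  cases j with
  | zero =>
    let e : M ≃ₗ[A] ULift.{v} M := ULift.moduleEquiv.symm
    have hk : LinearMap.ker (e.toLinearMap ∘ₗ R.aug) = LinearMap.ker R.aug := LinearEquiv.ker_comp _ _
    refine ⟨e.toLinearMap ∘ₗ R.aug, e.surjective.comp R.aug_surjective, ?_, ⟨?_⟩⟩
    · exact hk ▸ R.minimal_aug
    · exact LinearEquiv.ofEq _ _ (hk.trans R.exact_zero.linearMap_ker_eq) ≪≫ₗ
        ULift.moduleEquiv.symm
  | succ j =>
    let e : LinearMap.range (R.diff j) ≃ₗ[A] ULift.{u} (LinearMap.range (R.diff j)) :=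
      ULift.moduleEquiv.symm
    have hk : LinearMap.ker (e.toLinearMap ∘ₗ (R.diff j).rangeRestrict) =
        LinearMap.ker (R.diff j) := by
      rw [LinearEquiv.ker_comp, LinearMap.ker_rangeRestrict]
    refine ⟨e.toLinearMap ∘ₗ (R.diff j).rangeRestrict,
      e.surjective.comp (R.diff j).surjective_rangeRestrict, ?_, ⟨?_⟩⟩
    · exact hk ▸ R.minimal_diff j
    · exact LinearEquiv.ofEq _ _ (hk.trans (R.exact_succ j).linearMap_ker_eq) ≪≫ₗ
        ULift.moduleEquiv.symm

/-! ### Stable equivalence and the dimension formula -/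

section StableEquivalence

variable (A : Type v) [Ring A]

/-- Two modules are stably equivalent if they become isomorphic after adding finitely generated
projective modules. -/
def StablyEquivalent (X Y : Type*) [AddCommGroup X] [Module A X] [AddCommGroup Y] [Module A Y] :
    Prop :=
  ∃ B C : ModuleCat.{v} A, Module.Finite A B ∧ Module.Projective A B ∧ Module.Finite A C ∧
    Module.Projective A C ∧ Nonempty ((X × B) ≃ₗ[A] Y × C)

variable {A}
variable {X Y : Type*} [AddCommGroup X] [Module A X] [AddCommGroup Y] [Module A Y]

theorem StablyEquivalent.of_equiv (e : X ≃ₗ[A] Y) : StablyEquivalent A X Y :=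
  ⟨ModuleCat.of A PUnit.{v + 1}, ModuleCat.of A PUnit.{v + 1},
    inferInstanceAs (Module.Finite A PUnit.{v + 1}),
    inferInstanceAs (Module.Projective A PUnit.{v + 1}),
    inferInstanceAs (Module.Finite A PUnit.{v + 1}),
    inferInstanceAs (Module.Projective A PUnit.{v + 1}), ⟨e.prodCongr (LinearEquiv.refl _ _)⟩⟩

theorem StablyEquivalent.congr {X' Y' : Type*} [AddCommGroup X'] [Module A X'] [AddCommGroup Y']
    [Module A Y'] (h : StablyEquivalent A X Y) (e : X ≃ₗ[A] X') (e' : Y ≃ₗ[A] Y') :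
    StablyEquivalent A X' Y' := by
  obtain ⟨B, C, hB, hB', hC, hC', ⟨f⟩⟩ := h
  exact ⟨B, C, hB, hB', hC, hC', ⟨(e.symm.prodCongr (LinearEquiv.refl _ _)) ≪≫ₗ f ≪≫ₗ
    e'.prodCongr (LinearEquiv.refl _ _)⟩⟩

/-- The kernel of the product of a map with an identity. -/
def kerProdMapIdEquiv {P : Type*} [AddCommGroup P] [Module A P] (p : P →ₗ[A] X) (B : Type*)
    [AddCommGroup B] [Module A B] :
    LinearMap.ker (p.prodMap (LinearMap.id : B →ₗ[A] B)) ≃ₗ[A] LinearMap.ker p where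
  toFun w := ⟨(w : P × B).1, congrArg Prod.fst (LinearMap.mem_ker.mp w.2)⟩
  map_add' _ _ := rfl
  map_smul' _ _ := rfl
  invFun y := ⟨(y, 0), Prod.ext y.2 rfl⟩
  left_inv w := Subtype.ext (Prod.ext rfl (congrArg Prod.snd (LinearMap.mem_ker.mp w.2)).symm)
  right_inv _ := rfl

variable {F P : Type v} [AddCommGroup F] [Module A F] [AddCommGroup P] [Module A P]
  [Module.Projective A F] [Module.Projective A P]
  {q : F →ₗ[A] X} {p : P →ₗ[A] Y}

/-- Schanuel's lemma applies to q ⊕ id_B, transported along `e`, and p ⊕ id_C; adding an identity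
does not change a kernel. -/
theorem exists_ker_prod_equiv (hq : Function.Surjective q) (hp : Function.Surjective p)
    {B C : Type v} [AddCommGroup B] [Module A B] [AddCommGroup C] [Module A C]
    [Module.Projective A B] [Module.Projective A C] (e : (X × B) ≃ₗ[A] Y × C) :
    Nonempty ((LinearMap.ker q × (P × C)) ≃ₗ[A] LinearMap.ker p × (F × B)) := by
  let q' := e.toLinearMap ∘ₗ q.prodMap (LinearMap.id : B →ₗ[A] B)
  let p' := p.prodMap (LinearMap.id : C →ₗ[A] C)
  have hq' : Function.Surjective q' := e.surjective.comp (hq.prodMap Function.surjective_id)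
  have hp' : Function.Surjective p' := hp.prodMap Function.surjective_id
  obtain ⟨f⟩ := schanuel p' q' hp' hq'
  have hk : LinearMap.ker q' = LinearMap.ker (q.prodMap (LinearMap.id : B →ₗ[A] B)) :=
    LinearEquiv.ker_comp _ _
  exact ⟨((LinearEquiv.ofEq _ _ hk ≪≫ₗ kerProdMapIdEquiv q B).symm.prodCongr
    (LinearEquiv.refl A (P × C))) ≪≫ₗ f ≪≫ₗ
    (kerProdMapIdEquiv p C).prodCongr (LinearEquiv.refl A (F × B))⟩

theorem StablyEquivalent.ker [Module.Finite A F] [Module.Finite A P]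
    (h : StablyEquivalent A X Y) (hq : Function.Surjective q)
    (hp : Function.Surjective p) :
    StablyEquivalent A (LinearMap.ker q) (LinearMap.ker p) := by
  obtain ⟨B, C, hB, hB', hC, hC', ⟨e⟩⟩ := h
  exact ⟨ModuleCat.of A (P × C), ModuleCat.of A (F × B), inferInstanceAs (Module.Finite A (P × C)),
    inferInstanceAs (Module.Projective A (P × C)), inferInstanceAs (Module.Finite A (F × B)),
    inferInstanceAs (Module.Projective A (F × B)), exists_ker_prod_equiv hq hp e⟩

/-- The dimension of `Hom(Ω(Y), N)`, where `Ω(Y)` is the kernel of a projective cover of `Y`, in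
terms of a possibly non-minimal syzygy of a stably equivalent module `X`. -/
theorem StablyEquivalent.finrank_hom_ker [Module.Finite A F] [Module.Finite A P]
    {K : Type u} [Field K] [IsAlgClosed K] [Algebra K A]
    [Module.Finite K A] [IsArtinianRing A] [Module.Finite A X] [Module.Finite A Y]
    (h : StablyEquivalent A X Y) (hq : Function.Surjective q)
    (hp : Function.Surjective p) (hs : IsSuperfluous (LinearMap.ker p))
    {T : Finset (Submodule A A)} (hT : ∀ m ∈ T, IsSimpleModule A (A ⧸ m))
    (hinj : ∀ m ∈ T, ∀ m' ∈ T, Nonempty ((A ⧸ m) ≃ₗ[A] A ⧸ m') → m = m')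
    (hall : ∀ m : Submodule A A, IsSimpleModule A (A ⧸ m) →
        ∃ m' ∈ T, Nonempty ((A ⧸ m) ≃ₗ[A] A ⧸ m'))
    {N : Type w} [AddCommGroup N] [Module K N] [Module A N] [IsScalarTower K A N]
    [Module.Finite K N] :
    Module.finrank K (LinearMap.ker p →ₗ[A] N) + Module.finrank K (F →ₗ[A] N) =
      Module.finrank K (LinearMap.ker q →ₗ[A] N) + ∑ m ∈ T, Module.finrank K (X →ₗ[A] A ⧸ m) *
        Module.finrank K (projectiveCover A (A ⧸ m) →ₗ[A] N) := by
  obtain ⟨B, C, hB, hB', hC, hC', ⟨e⟩⟩ := h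
  obtain ⟨f⟩ := exists_ker_prod_equiv hq hp e
  have hN : IsFiniteLength A N := by
    have : Module.Finite A N := Module.Finite.of_restrictScalars_finite K A N
    exact isFiniteLength_iff_isNoetherian_isArtinian.mpr ⟨inferInstance, inferInstance⟩
  have h1 := finrank_hom_congr_left (K := K) (N := N) f
  rw [finrank_hom_prod, finrank_hom_prod, finrank_hom_prod, finrank_hom_prod] at h1
  -- Expand over the simples S. Since hom(P, S) = hom(Y, S) and X ⊕ B ≅ Y ⊕ C, the multiplicities of
  -- P and C together are those of B plus hom(X, S).
  have h2 : Module.finrank K (P →ₗ[A] N) + Module.finrank K (C →ₗ[A] N) =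
      Module.finrank K (B →ₗ[A] N) + ∑ m ∈ T, Module.finrank K (X →ₗ[A] A ⧸ m) *
        Module.finrank K (projectiveCover A (A ⧸ m) →ₗ[A] N) := by
    rw [finrank_hom_projective_eq_sum hT hinj hall (Q := P) hN,
      finrank_hom_projective_eq_sum hT hinj hall (Q := C) hN,
      finrank_hom_projective_eq_sum hT hinj hall (Q := B) hN,
      ← Finset.sum_add_distrib, ← Finset.sum_add_distrib]
    refine Finset.sum_congr rfl fun m hm => ?_
    have := hT m hm
    have := Module.Finite.of_surjective (m.mkQ.restrictScalars K) m.mkQ_surjective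
    have h3 := finrank_hom_congr_left (K := K) (N := A ⧸ m) e
    rw [finrank_hom_prod, finrank_hom_prod] at h3
    rw [finrank_hom_simple_eq hp hs, ← add_mul, ← h3, ← add_mul, add_comm]
  omega

end StableEquivalence

/-! ### Regular families on the product variety and the conclusion -/

section Main

theorem isOpen_setOf_le_of_isUpperSemicontinuousFor {K : Type u} [Field K] {A : Type v} [Ring A]
    [Algebra K A] [Module.Finite K A] {d d' : ℕ}
    {f : ModVariety K A d × ModVariety K A d' → ℕ}
    (hf : IsUpperSemicontinuousFor (MvPolynomial.aeval fun c x =>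
      pairCoordinates K A d d' x c).range f) (n : ℤ) :
    IsOpen[pairZariski K A d d'] {x | (f x : ℤ) ≤ n} := by
  have heval : ∀ (p : MvPolynomial _ K) (x : ModVariety K A d × ModVariety K A d'),
      MvPolynomial.aeval (fun c x => pairCoordinates K A d d' x c) p x =
        MvPolynomial.eval (pairCoordinates K A d d' x) p := fun p x => by
    induction p using MvPolynomial.induction_on with
    | C a => simp
    | add p q hp hq => simp [hp, hq]
    | mul_X p c hp => simp [hp]
  -- All polynomials whose nonvanishing locus lies in the sublevel set; these loci cover it by
  -- semicontinuity at each of its points.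
  let S : Set (MvPolynomial _ K) := {p | ∀ x : ModVariety K A d × ModVariety K A d',
    MvPolynomial.eval (pairCoordinates K A d d' x) p ≠ 0 → (f x : ℤ) ≤ n}
  refine (@isOpen_induced_iff _ _ (affineZariski _ K) _ (pairCoordinates K A d d')).mpr
    ⟨{y | ∀ p ∈ S, MvPolynomial.eval y p = 0}ᶜ, ?_, ?_⟩
  · exact ⟨S, compl_compl _⟩
  · ext x
    simp only [Set.mem_preimage, Set.mem_compl_iff, Set.mem_ofPred_eq]
    constructor
    · intro hx
      push Not at hx
      obtain ⟨p, hp, hpx⟩ := hx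
      exact hp x hpx
    · intro hx hcon
      obtain ⟨g, ⟨p, rfl⟩, hg, hgf⟩ := hf x
      refine hg ((heval p x).trans (hcon p fun y hy => ?_))
      exact (Nat.cast_le.mpr (hgf y ((heval p y).trans_ne hy))).trans hx

variable {K : Type u} [Field K] {A : Type v} [Ring A] [Algebra K A] [Module.Finite K A]

/-- The matrix entries of a representation are regular as soon as this holds on a basis. -/
theorem isRegularFamily_of_basis {X : Type*} {R : Subalgebra K (X → K)} {d : ℕ}
    {φ : X → ModVariety K A d}
    (h : ∀ b i j, (fun x => φ x (Module.finBasis K A b) i j) ∈ R) : IsRegularFamily R φ := by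
  intro a i j
  have : (fun x => φ x a i j) =
      ∑ b, (Module.finBasis K A).repr a b • fun x => φ x (Module.finBasis K A b) i j := by
    funext x
    conv_lhs => rw [← (Module.finBasis K A).sum_repr a, map_sum, Matrix.sum_apply]
    simp
  rw [this]
  exact sum_mem fun b _ => R.smul_mem (h b i j) _

theorem isRegularFamily_fst (d d' : ℕ) :
    IsRegularFamily (MvPolynomial.aeval fun c x => pairCoordinates K A d d' x c).range
      (Prod.fst : ModVariety K A d × ModVariety K A d' → ModVariety K A d) :=
  isRegularFamily_of_basis fun b i j => ⟨MvPolynomial.X (Sum.inl (b, i, j)), by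
    simp [pairCoordinates]⟩

theorem isRegularFamily_snd (d d' : ℕ) :
    IsRegularFamily (MvPolynomial.aeval fun c x => pairCoordinates K A d d' x c).range
      (Prod.snd : ModVariety K A d × ModVariety K A d' → ModVariety K A d') :=
  isRegularFamily_of_basis fun b i j => ⟨MvPolynomial.X (Sum.inr (b, i, j)), by
    simp [pairCoordinates]⟩

variable (A) in
/-- A possibly non-minimal `j`-th syzygy can be chosen regularly on `mod(A,d)`. -/
theorem exists_regular_iterated_syzygy [IsArtinianRing A] {d : ℕ}
    (R : ∀ M : ModVariety K A d, MinimalProjectiveResolution A (ModuleOf M)) (j : ℕ) :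
    ∃ (e : ℕ) (Φ : ModVariety K A d → ModVariety K A e),
      (∀ M, StablyEquivalent A (ModuleOf (Φ M)) ((R M).syzygy j)) ∧
      ∀ {X : Type max u v} {S : Subalgebra K (X → K)} {φ : X → ModVariety K A d},
        IsRegularFamily S φ → IsRegularFamily S fun x => Φ (φ x) := by
  induction j with
  | zero => exact ⟨d, id, fun M => .of_equiv ULift.moduleEquiv.symm, fun h => h⟩
  | succ j ih =>
    obtain ⟨e, Φ, hΦ, hreg⟩ := ih
    obtain ⟨e', Ψ, hΨ, hreg'⟩ := exists_regular_syzygy K A e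
    refine ⟨e', fun M => Ψ (Φ M), fun M => ?_, fun h => hreg' (hreg h)⟩
    obtain ⟨p, hp, -, ⟨f⟩⟩ := (R M).exists_cover_syzygy j
    obtain ⟨g⟩ := hΨ (Φ M)
    have := (R M).finite j
    have := (R M).projective j
    exact ((hΦ M).ker (freeCover_surjective _) hp).congr g f

theorem isUpperSemicontinuousFor_finrank_hom_syzygy [IsAlgClosed K] {d d' : ℕ}
    (R : ∀ M : ModVariety K A d, MinimalProjectiveResolution A (ModuleOf M)) (j : ℕ) :
    IsUpperSemicontinuousFor
      (MvPolynomial.aeval fun c x => pairCoordinates K A d d' x c).range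
      fun x => Module.finrank K ((R x.1).syzygy j →ₗ[A] ModuleOf x.2) := by
  have : IsArtinianRing A := IsArtinianRing.of_finite K A
  have hfst := isRegularFamily_fst (K := K) (A := A) d d'
  have hsnd := isRegularFamily_snd (K := K) (A := A) d d'
  cases j with
  | zero =>
    convert isUpperSemicontinuousFor_finrank_hom hfst hsnd using 2 with x
    exact finrank_hom_congr_left ULift.moduleEquiv
  | succ j =>
    obtain ⟨e, Φ, hΦ, hreg⟩ := exists_regular_iterated_syzygy A R j
    obtain ⟨e', Ψ, hΨ, hreg'⟩ := exists_regular_syzygy K A e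
    obtain ⟨T, hT, hinj, hall⟩ := exists_finset_simple_representatives (A := A)
    -- The constant is hom(A^e, N) for the standard free cover A^e of Φ(M).
    refine .of_add_const (e * d') ?_
    have hformula : ∀ x : ModVariety K A d × ModVariety K A d',
        Module.finrank K ((R x.1).syzygy (j + 1) →ₗ[A] ModuleOf x.2) + e * d' =
        Module.finrank K (ModuleOf (Ψ (Φ x.1)) →ₗ[A] ModuleOf x.2) +
          ∑ m ∈ T, Module.finrank K (ModuleOf (Φ x.1) →ₗ[A] A ⧸ m) *
            Module.finrank K (projectiveCover A (A ⧸ m) →ₗ[A] ModuleOf x.2) := fun x => by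
      obtain ⟨p, hp, hs, ⟨f⟩⟩ := (R x.1).exists_cover_syzygy j
      obtain ⟨g⟩ := hΨ (Φ x.1)
      have := (R x.1).finite j
      have := (R x.1).projective j
      have := Module.Finite.of_restrictScalars_finite K A (ModuleOf (Φ x.1))
      have := Module.Finite.of_surjective p hp
      have h := (hΦ x.1).finrank_hom_ker (K := K) (N := ModuleOf x.2)
        (freeCover_surjective (Φ x.1)) hp hs hT hinj hall
      rw [finrank_hom_free, ModuleOf.finrank_eq, finrank_hom_congr_left f,
        finrank_hom_congr_left g] at h
      exact h
    simp only [hformula]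
    refine .add (isUpperSemicontinuousFor_finrank_hom (hreg' (hreg hfst)) hsnd)
      (.sum T fun m _ => .mul ?_ ?_)
    -- Both `A ⧸ m` and its projective cover do not depend on `x`, so they give constant families.
    · have := Module.Finite.of_surjective (m.mkQ.restrictScalars K) m.mkQ_surjective
      obtain ⟨_, S, ⟨g⟩⟩ := exists_equiv_moduleOf (K := K) (A := A) (A ⧸ m)
      convert isUpperSemicontinuousFor_finrank_hom (hreg hfst) (.const _ S) using 2 with x
      exact finrank_hom_congr_right g
    · have : Module.Finite K (projectiveCover A (A ⧸ m)) := Module.Finite.trans A _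
      obtain ⟨_, S, ⟨g⟩⟩ := exists_equiv_moduleOf (K := K) (A := A) (projectiveCover A (A ⧸ m))
      convert isUpperSemicontinuousFor_finrank_hom (.const _ S) hsnd using 2 with x
      exact finrank_hom_congr_left g

end Main

/-- The existence clause keeps the quantification over `R` from being vacuous. -/
theorem corollary1p3 {K : Type u} [Field K] [IsAlgClosed K]
    {A : Type v} [Ring A] [Algebra K A] [Module.Finite K A] (d d' j : ℕ) :
    (∀ M : ModVariety K A d, Nonempty (MinimalProjectiveResolution A (ModuleOf M))) ∧
    ∀ R : ∀ M : ModVariety K A d, MinimalProjectiveResolution A (ModuleOf M),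
      ∀ n : ℤ, IsOpen[pairZariski K A d d']
        {x : ModVariety K A d × ModVariety K A d' |
          (Module.finrank K ((R x.1).syzygy j →ₗ[A] ModuleOf x.2) : ℤ) ≤ n} := by
  have : IsArtinianRing A := IsArtinianRing.of_finite K A
  refine ⟨fun M => ?_, fun R n => isOpen_setOf_le_of_isUpperSemicontinuousFor
    (isUpperSemicontinuousFor_finrank_hom_syzygy R j) n⟩
  have := Module.Finite.of_restrictScalars_finite K A (ModuleOf M)
  exact ⟨minimalProjectiveResolution A (ModuleOf M)⟩
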